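/- Let $n,m\ge 1$ be integers, $0<\tau_1\le\dots\le\tau_n$ real numbers, $L_+,\delta^0,\varepsilon>0$, and let $$t^*(m)=\min_{1\le j\le n}\Big(\sum_{i=1}^j\frac1{\tau_i}\Big)^{-1}(m+j).$$ **Function class.** $\mathcal F^m_{\delta^0,L_+}$ consists of the functions $f=\frac1m\sum_{i=1}^m f_i$ on $\mathbb R^d$ (any dimension $d$), with $f_i:\mathbb R^d\to\mathbb R$ differentiable, $f(0)-\inf f\le\delta^0$ (in particular $f$ is bounded below) and $\frac1m\sum_{i=1}^m\|\nabla f_i(x)-\nabla f_i(y)\|^2\le L_+^2\|x-y\|^2$ for all $x,y\in\mathbb R^d$. **Oracles.** The oracle $O_{\tau}$ has a state $(s_t,s_x,s_q)\in\mathbb R_{\ge0}\times\mathbb R^d\times\{0,1\}$. Called at time $t$ and point $x$, it returns a new state and a vector, namely $((t,x,1),0)$ if $s_q=0$; $((s_t,s_x,1),0)$ if $s_q=1$ and $t<s_t+\tau$; and $((0,0,0),\nabla f_j(s_x))$ if $s_q=1$ and $t\ge s_t+\tau$, where $j$ is uniformly distributed on $\{1,\dots,m\}$ and all draws are i.i.d.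 **Algorithms.** A zero-respecting algorithm on $\mathbb R^d$ for $n$ workers is a sequence of maps $A^k:(\mathbb R^d)^k\to\mathbb R_{\ge0}\times\{1,\dots,n\}\times\mathbb R^d$, $k\ge0$, written $A^k(g^1,\dots,g^k)=(t^{k+1},i^{k+1},x^k)$, such that for all $g^1,g^2,\dots\in\mathbb R^d$ one has $t^{k+1}\ge t^k$ for all $k\ge1$ and $\operatorname{supp}(x^k)\subseteq\bigcup_{j=1}^k\operatorname{supp}(g^j)$ for all $k\ge0$, where $\operatorname{supp}(x)$ is the set of coordinates in which $x$ is nonzero. **Protocol.** All oracle states are initially $(0,0,0)$ and $t^0=0$. For $k=0,1,\dots$, let $(t^{k+1},i^{k+1},x^k)=A^k(g^1,\dots,g^k)$; then call the oracle $O_{\tau_{i^{k+1}}}$ of worker $i^{k+1}$ at time $t^{k+1}$ and point $x^k$, let $g^{k+1}$ be the vector it returns, and update the state of that worker only. Put $S_t=\{k\ge0: t^k\le t\}$. **Theorem.** 1. There are universal constants $c_1,c_2,c_3>0$ such that, for all $n,m,\tau_1,\dots,\tau_n,L_+,\delta^0,\varepsilon$ as above with $\varepsilon<c_1L_+\delta^0$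 and $\delta^0L_+/\varepsilon>c_2\sqrt m$, there is a dimension $d$ such that for every zero-respecting algorithm on $\mathbb R^d$ there is a function $f\in\mathcal F^m_{\delta^0,L_+}$ on $\mathbb R^d$ for which the protocol with oracles $O_{\tau_1},\dots,O_{\tau_n}$ satisfies $$\mathbb E\Big[\inf_{k\in S_t}\|\nabla f(x^k)\|^2\Big]>\varepsilon\qquad\text{at}\quad t=c_3\,\frac{\delta^0L_+}{\sqrt m\,\varepsilon}\,t^*(m).$$ 2. There are universal constants $c_1,c>0$ such that, for all $n,m,\tau_1,\dots,\tau_n,L_+,\delta^0,\varepsilon$ as above with only $\varepsilon<c_1L_+\delta^0$, the same conclusion holds at $$t=c\Big(t^*(m)+\frac{\delta^0L_+}{\sqrt m\,\varepsilon}\,t^*(m)\Big).$$ Since $S_t$ grows with $t$, the inequality also holds at all smaller $t\ge 0$. -/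

import Mathlib

open MeasureTheory ProbabilityTheory
open scoped ENNReal NNReal

universe u

namespace TimeOracle

noncomputable section

/-- `ℝ^d` with the Euclidean norm. -/
abbrev Vec (d : ℕ) : Type := EuclideanSpace ℝ (Fin d)

/-- The finite-sum objective `f = (1/m) ∑ f_i`. -/
def avg {m d : ℕ} (f : Fin m → Vec d → ℝ) (x : Vec d) : ℝ :=
  (1 / (m : ℝ)) * ∑ i, f i x

/-- The function class `F^m_{δ, L}`, as a predicate on the family of summands
`f_1, …, f_m : ℝ^d → ℝ`. -/
structure FunctionClass {m d : ℕ} (δ L : ℝ) (f : Fin m → Vec d → ℝ) : Prop where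
  differentiable : ∀ i, Differentiable ℝ (f i)
  bddBelow : BddBelow (Set.range (avg f))
  gap : avg f 0 - (⨅ x, avg f x) ≤ δ
  smooth : ∀ x y : Vec d,
    (1 / (m : ℝ)) * ∑ i, ‖gradient (f i) x - gradient (f i) y‖ ^ 2 ≤ L ^ 2 * ‖x - y‖ ^ 2

/-- The state `(s_t, s_x, s_q)` of an oracle; `busy` is `s_q`. -/
structure OracleState (d : ℕ) where
  time : ℝ≥0
  point : Vec d
  busy : Bool

/-- The state `(0, 0, 0)`. -/
def OracleState.idle (d : ℕ) : OracleState d := ⟨0, 0, false⟩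

/-- The oracle `O_τ` called at time `t` and point `x` in state `s`, where `j` is the random index
drawn for this call; returns the new state and the output vector. -/
def oracle {m d : ℕ} (f : Fin m → Vec d → ℝ) (τ : ℝ) (j : Fin m) (t : ℝ≥0) (x : Vec d)
    (s : OracleState d) : OracleState d × Vec d :=
  if s.busy = false then (⟨t, x, true⟩, 0)
  else if (t : ℝ) < s.time + τ then (⟨s.time, s.point, true⟩, 0)
  else (OracleState.idle d, gradient (f j) s.point)

/-- The support of a vector. -/
def supp {d : ℕ} (x : Vec d) : Set (Fin d) := {i | x i ≠ 0}

/-- Zero-respecting algorithms for `n` workers on `ℝ^d`: `A^k` sends `(g^1, …, g^k)` to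
`(t^{k+1}, i^{k+1}, x^k)`. -/
structure ZeroRespectingAlgorithm (n d : ℕ) where
  step : (k : ℕ) → (Fin k → Vec d) → ℝ≥0 × Fin n × Vec d
  time_mono : ∀ (k : ℕ) (g : Fin (k + 1) → Vec d),
    (step k (Fin.init g)).1 ≤ (step (k + 1) g).1
  zero_respecting : ∀ (k : ℕ) (g : Fin k → Vec d),
    supp (step k g).2.2 ⊆ ⋃ j, supp (g j)

section Protocol

variable {n m d : ℕ} (A : ZeroRespectingAlgorithm n d) (τ : Fin n → ℝ)
  (f : Fin m → Vec d → ℝ) (ξ : ℕ → Fin m)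

/-- The time multiple oracles protocol after `k` iterations: the oracle states
`(s_1^k, …, s_n^k)` and the received vectors `(g^1, …, g^k)`. Here `ξ k` is the index drawn
for the oracle call of iteration `k` (it is used only if that call returns a gradient). -/
def protocol : (k : ℕ) → (Fin n → OracleState d) × (Fin k → Vec d)
  | 0 => (fun _ => OracleState.idle d, Fin.elim0)
  | k + 1 =>
    let s := (protocol k).1
    let g := (protocol k).2
    let a := A.step k g
    let o := oracle f (τ a.2.1) (ξ k) a.1 a.2.2 (s a.2.1)
    (Function.update s a.2.1 o.1, Fin.snoc (α := fun _ => Vec d) g o.2)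

/-- The times `t^k`, with `t^0 = 0`. -/
def iterTime : ℕ → ℝ≥0
  | 0 => 0
  | k + 1 => (A.step k (protocol A τ f ξ k).2).1

/-- The points `x^k`. -/
def iterPoint (k : ℕ) : Vec d := (A.step k (protocol A τ f ξ k).2).2.2

/-- `inf_{k ∈ S_t} ‖∇f(x^k)‖²` with `S_t = {k | t^k ≤ t}`, as an element of `[0, ∞]`. -/
def infGradSq (t : ℝ) : ℝ≥0∞ :=
  ⨅ k ∈ {k : ℕ | (iterTime A τ f ξ k : ℝ) ≤ t}, ‖gradient (avg f) (iterPoint A τ f ξ k)‖ₑ ^ 2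

end Protocol

/-- `ξ 0, ξ 1, …` are i.i.d. uniformly distributed on `[m]`. -/
structure IsUniformDraws {Ω : Type*} [MeasurableSpace Ω] (μ : Measure Ω) {m : ℕ}
    (ξ : ℕ → Ω → Fin m) : Prop where
  measurable : ∀ k, Measurable (ξ k)
  indep : iIndepFun ξ μ
  uniform : ∀ k j, μ {ω | ξ k ω = j} = (m : ℝ≥0∞)⁻¹

/-- The equilibrium time
`t^*(S) = min_{j ∈ [n]} (∑_{i ≤ j} 1/τ_i)^{-1} (S + j)`; workers are numbered from `0` here. -/
def equilibriumTime {n : ℕ} (τ : Fin n → ℝ) (S : ℝ) : ℝ :=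
  ⨅ j : Fin n, (∑ i ∈ Finset.Iic j, 1 / τ i)⁻¹ * (S + ((j : ℕ) + 1))

end

end TimeOracle

namespace TimeOracle

/-! The bound is pathwise: it holds for every sequence of draws, so the expectation plays no role,
and the hard function is fixed before the algorithm.

The summands live on `m` disjoint blocks of coordinates, each carrying a chain, and a gradient of
one summand uncovers at most one new coordinate of its own block (`ZeroChain`). Cut time into
windows of length `s`, a quarter of the equilibrium time. A gradient computed across a window
boundary started from a point known in an earlier window, so all such gradients together advance
each block by at most one coordinate per window. Gradients computed inside one window number at most
`m / 3` (`three_mul_sum_floor_le`). Summing both contributions over the blocks (`support_invariant`,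
`sum_freshCount_le`) shows that at least half of the chains are incomplete until a time proportional
to `T` windows (`card_incomplete`).

An incomplete chain has one partial derivative bounded away from zero (`exists_chainSlope_le`), so
half of the blocks force a large gradient of the average. Since the blocks are disjoint,
mean-squared smoothness allows each block a Lipschitz constant `√m * L`. The gap budget then permits
chains of length of order `δ * L / (√m * ε)`, which gives `exists_hard_chain`. If that number is too
small for a chain, blocks of length one with quadratic summands handle a fraction of the equilibrium
time (`exists_hard_quadratic`). -/

/-- The coordinates are arranged in `m` blocks of length `T`, and a gradient of the `j`-th summand
reveals at most one further coordinate of the `j`-th block. -/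
def ZeroChain {m d T : ℕ} (e : Fin m × Fin T ≃ Fin d) (f : Fin m → Vec d → ℝ) : Prop :=
  ∀ (j : Fin m) (x : Vec d) (p : Fin m → ℕ),
    (∀ b i, x (e (b, i)) ≠ 0 → (i : ℕ) < p b) →
    ∀ b i, gradient (f j) x (e (b, i)) ≠ 0 → (i : ℕ) < p b + if j = b then 1 else 0

/-! ### Progress of the support along the protocol. -/

section Trajectory

variable {n m d : ℕ} (A : ZeroRespectingAlgorithm n d) (τ : Fin n → ℝ)
  (f : Fin m → Vec d → ℝ) (ξ : ℕ → Fin m)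

/-- The worker called in iteration `k`. -/
noncomputable def iterWorker (k : ℕ) : Fin n := (A.step k (protocol A τ f ξ k).2).2.1

/-- The state of worker `w` before iteration `k`. -/
noncomputable def workerState (k : ℕ) (w : Fin n) : OracleState d := (protocol A τ f ξ k).1 w

/-- The outcome of the oracle call of iteration `k`. -/
noncomputable def callResult (k : ℕ) : OracleState d × Vec d :=
  oracle f (τ (iterWorker A τ f ξ k)) (ξ k) (iterTime A τ f ξ (k + 1)) (iterPoint A τ f ξ k)
    (workerState A τ f ξ k (iterWorker A τ f ξ k))

lemma workerState_succ (k : ℕ) (w : Fin n) :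
    workerState A τ f ξ (k + 1) w =
      if w = iterWorker A τ f ξ k then (callResult A τ f ξ k).1 else workerState A τ f ξ k w := by
  have h : (protocol A τ f ξ (k + 1)).1 = Function.update (protocol A τ f ξ k).1
    (iterWorker A τ f ξ k) (callResult A τ f ξ k).1 := rfl
  rw [workerState, h, Function.update_apply]
  rfl

lemma protocol_succ_snd (k : ℕ) :
    (protocol A τ f ξ (k + 1)).2 =
      Fin.snoc (α := fun _ => Vec d) (protocol A τ f ξ k).2 (callResult A τ f ξ k).2 := rfl

lemma iterTime_le_succ (k : ℕ) : iterTime A τ f ξ k ≤ iterTime A τ f ξ (k + 1) := by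
  cases k with
  | zero => exact zero_le
  | succ k =>
    have h := A.time_mono k (protocol A τ f ξ (k + 1)).2
    rw [protocol_succ_snd, Fin.init_snoc] at h
    exact h

/-- The call of iteration `k` returns a gradient. -/
def Returns (k : ℕ) : Prop :=
  (workerState A τ f ξ k (iterWorker A τ f ξ k)).busy = true ∧
    ((workerState A τ f ξ k (iterWorker A τ f ξ k)).time : ℝ) + τ (iterWorker A τ f ξ k) ≤
      iterTime A τ f ξ (k + 1)

/-- The call of iteration `k` returns a gradient whose computation started in the same
time window of length `s`. -/
def Fresh (s : ℝ) (k : ℕ) : Prop :=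
  Returns A τ f ξ k ∧
    ⌊((workerState A τ f ξ k (iterWorker A τ f ξ k)).time : ℝ) / s⌋₊ =
      ⌊(iterTime A τ f ξ (k + 1) : ℝ) / s⌋₊

open Classical in
/-- The number of fresh gradients of the `b`-th summand among the first `k` calls. -/
noncomputable def freshCount (s : ℝ) (k : ℕ) (b : Fin m) : ℕ :=
  ((Finset.range k).filter fun i => Fresh A τ f ξ s i ∧ ξ i = b).card

open Classical in
/-- The number of fresh gradients of worker `w` in the `q`-th window among the first `k` calls. -/
noncomputable def windowCount (s : ℝ) (k : ℕ) (w : Fin n) (q : ℕ) : ℕ :=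
  ((Finset.range k).filter fun i => Fresh A τ f ξ s i ∧ iterWorker A τ f ξ i = w ∧
    ⌊(iterTime A τ f ξ (i + 1) : ℝ) / s⌋₊ = q).card

open Classical in
lemma freshCount_succ (s : ℝ) (k : ℕ) (b : Fin m) :
    freshCount A τ f ξ s (k + 1) b =
      freshCount A τ f ξ s k b + if Fresh A τ f ξ s k ∧ ξ k = b then 1 else 0 := by
  unfold freshCount
  rw [Finset.range_add_one, Finset.filter_insert]
  split_ifs <;> simp

open Classical in
lemma windowCount_succ (s : ℝ) (k : ℕ) (w : Fin n) (q : ℕ) :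
    windowCount A τ f ξ s (k + 1) w q =
      windowCount A τ f ξ s k w q + if Fresh A τ f ξ s k ∧ iterWorker A τ f ξ k = w ∧
        ⌊(iterTime A τ f ξ (k + 1) : ℝ) / s⌋₊ = q then 1 else 0 := by
  unfold windowCount
  rw [Finset.range_add_one, Finset.filter_insert]
  split_ifs <;> simp

/-- The three possible outcomes of an oracle call. -/
lemma callResult_cases (k : ℕ) :
    ((workerState A τ f ξ k (iterWorker A τ f ξ k)).busy = false ∧ ¬ Returns A τ f ξ k ∧
      callResult A τ f ξ k = (⟨iterTime A τ f ξ (k + 1), iterPoint A τ f ξ k, true⟩, 0)) ∨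
    ((workerState A τ f ξ k (iterWorker A τ f ξ k)).busy = true ∧ ¬ Returns A τ f ξ k ∧
      callResult A τ f ξ k = (workerState A τ f ξ k (iterWorker A τ f ξ k), 0)) ∨
    ((workerState A τ f ξ k (iterWorker A τ f ξ k)).busy = true ∧ Returns A τ f ξ k ∧
      callResult A τ f ξ k = (OracleState.idle d,
        gradient (f (ξ k)) (workerState A τ f ξ k (iterWorker A τ f ξ k)).point)) := by
  unfold callResult oracle Returns
  generalize workerState A τ f ξ k (iterWorker A τ f ξ k) = S
  rcases S with ⟨a, x, _ | _⟩
  · simp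
  · by_cases h : (iterTime A τ f ξ (k + 1) : ℝ) < a + τ (iterWorker A τ f ξ k)
    · simp [h]
    · simp [h, not_lt.1 h]

/-- If all received vectors are supported below `p`, so is the next query point. -/
lemma iterPoint_lt {T : ℕ} (e : Fin m × Fin T ≃ Fin d) (k : ℕ) (p : Fin m → ℕ)
    (h : ∀ j b i, (protocol A τ f ξ k).2 j (e (b, i)) ≠ 0 → (i : ℕ) < p b) (b : Fin m) (i : Fin T)
    (hx : iterPoint A τ f ξ k (e (b, i)) ≠ 0) : (i : ℕ) < p b := by
  have := A.zero_respecting k (protocol A τ f ξ k).2 (a := e (b, i)) hx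
  obtain ⟨j, hj⟩ := Set.mem_iUnion.1 this
  exact h j b i hj

lemma floor_iterTime_le_succ {s : ℝ} (hs : 0 < s) (k : ℕ) :
    ⌊(iterTime A τ f ξ k : ℝ) / s⌋₊ ≤ ⌊(iterTime A τ f ξ (k + 1) : ℝ) / s⌋₊ := by
  have := iterTime_le_succ A τ f ξ k
  gcongr

/-- The frontier of a block is charged to its fresh gradients plus the index of the current window.
For a busy worker the window is the one in which its computation started, since its stored point
reflects only what was known then. -/
lemma support_invariant {T : ℕ} {e : Fin m × Fin T ≃ Fin d} (hf : ZeroChain e f)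
    (hτ : ∀ w, 0 < τ w) {s : ℝ} (hs : 0 < s) (k : ℕ) :
    (∀ j b i, (protocol A τ f ξ k).2 j (e (b, i)) ≠ 0 →
      (i : ℕ) < freshCount A τ f ξ s k b + ⌊(iterTime A τ f ξ k : ℝ) / s⌋₊) ∧
    (∀ w, (workerState A τ f ξ k w).busy = true →
      ∀ b i, (workerState A τ f ξ k w).point (e (b, i)) ≠ 0 →
        (i : ℕ) < freshCount A τ f ξ s k b + ⌊((workerState A τ f ξ k w).time : ℝ) / s⌋₊) := by
  classical
  induction k with
  | zero =>
    exact ⟨fun j => j.elim0, fun w h => by simp [workerState, protocol, OracleState.idle] at h⟩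
  | succ k ih =>
    obtain ⟨ih1, ih2⟩ := ih
    have hmono := floor_iterTime_le_succ A τ f ξ hs k
    have hfc : ∀ b, freshCount A τ f ξ s k b ≤ freshCount A τ f ξ s (k + 1) b := fun b => by
      rw [freshCount_succ]; omega
    constructor
    · intro j b i
      rw [protocol_succ_snd]
      refine Fin.lastCases ?_ (fun j => ?_) j
      · rw [Fin.snoc_last]
        rcases callResult_cases A τ f ξ k with ⟨_, _, h⟩ | ⟨_, _, h⟩ | ⟨hb, hr, h⟩
        · simp [h]
        · simp [h]
        · rw [h]
          intro hne
          have key := hf (ξ k) _ _ (ih2 _ hb) b i hne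
          refine key.trans_le ?_
          by_cases hfr : Fresh A τ f ξ s k
          · have h2 := hfr.2
            rw [freshCount_succ]
            simp only [hfr, true_and]
            omega
          -- A stale gradient gains at most one coordinate over a point from a strictly earlier
          -- window, and the larger window index already pays for it.
          · have hlt : ⌊((workerState A τ f ξ k (iterWorker A τ f ξ k)).time : ℝ) / s⌋₊ <
                ⌊(iterTime A τ f ξ (k + 1) : ℝ) / s⌋₊ := by
              refine lt_of_le_of_ne ?_ fun h => hfr ⟨hr, h⟩
              have h1 := hr.2
              have h2 := hτ (iterWorker A τ f ξ k)
              refine Nat.floor_le_floor ?_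
              refine div_le_div_of_nonneg_right ?_ hs.le
              linarith
            have := hfc b
            split_ifs <;> omega
      · rw [Fin.snoc_castSucc]
        intro hne
        have := ih1 j b i hne
        have := hfc b
        omega
    · intro w
      rw [workerState_succ]
      split_ifs with hw
      · rcases callResult_cases A τ f ξ k with ⟨_, _, h⟩ | ⟨hb, _, h⟩ | ⟨hb, hr, h⟩
        · rw [h]
          intro _ b i hne
          have := iterPoint_lt A τ f ξ e k _ ih1 b i hne
          have := hfc b
          simp only
          omega
        · rw [h]
          intro _ b i hne
          have := ih2 _ hb b i hne
          have := hfc b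
          simp only
          omega
        · simp [h, OracleState.idle]
      · intro hb b i hne
        have := ih2 w hb b i hne
        have := hfc b
        omega

/-- The part of the `q`-th window of length `s` that lies before time `l`. -/
noncomputable def elapsed (s : ℝ) (q : ℕ) (l : ℝ) : ℝ := max 0 (min l ((q + 1) * s) - q * s)

lemma elapsed_mono (s : ℝ) (q : ℕ) : Monotone (elapsed s q) := fun a b h => by
  unfold elapsed
  gcongr

lemma elapsed_le {s : ℝ} (hs : 0 ≤ s) (q : ℕ) (l : ℝ) : elapsed s q l ≤ s := by
  unfold elapsed
  refine max_le hs ?_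
  linarith [min_le_right l ((q + 1) * s)]

lemma elapsed_floor {s : ℝ} (hs : 0 < s) {l : ℝ} (hl : 0 ≤ l) :
    elapsed s ⌊l / s⌋₊ l = l - ⌊l / s⌋₊ * s := by
  have h1 := (le_div_iff₀ hs).1 (Nat.floor_le (div_nonneg hl hs.le))
  have h2 := (div_lt_iff₀ hs).1 (Nat.lt_floor_add_one (l / s))
  unfold elapsed
  rw [min_eq_left h2.le, max_eq_right (by linarith)]

/-- Fresh computations of one worker occupy disjoint intervals of length at least `τ w` inside the
window. While the worker is busy only the time before its current start is counted, which leaves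
room for the computation in progress. -/
lemma windowCount_mul_le_elapsed (hτ : ∀ w, 0 < τ w) {s : ℝ} (hs : 0 < s) (k : ℕ) (w : Fin n)
    (q : ℕ) :
    windowCount A τ f ξ s k w q * τ w ≤ elapsed s q
      (if (workerState A τ f ξ k w).busy = true then (workerState A τ f ξ k w).time
        else iterTime A τ f ξ k : ℝ≥0) := by
  classical
  induction k with
  | zero => simp [windowCount, elapsed]
  | succ k ih =>
    have hmono := iterTime_le_succ A τ f ξ k
    rw [workerState_succ, windowCount_succ]
    by_cases hw : w = iterWorker A τ f ξ k
    · subst hw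
      simp only [if_true, true_and]
      rcases callResult_cases A τ f ξ k with ⟨hb, hr, h⟩ | ⟨hb, hr, h⟩ | ⟨hb, hr, h⟩
      · have : ¬ Fresh A τ f ξ s k := fun h => hr h.1
        simp only [hb, h, this, false_and, if_false, add_zero, if_true] at ih ⊢
        exact ih.trans (elapsed_mono s q (by exact_mod_cast hmono))
      · have : ¬ Fresh A τ f ξ s k := fun h => hr h.1
        simp only [hb, h, this, false_and, if_false, add_zero, if_true] at ih ⊢
        exact ih
      · simp only [hb, if_true] at ih
        simp only [h, OracleState.idle]
        have hret := hr.2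
        have hpos := hτ (iterWorker A τ f ξ k)
        split_ifs with hfr h0
        · simp at h0
        -- Start and end lie in the same window, so the elapsed part grows by the full duration,
        -- which is at least `τ`.
        · obtain ⟨hfr, rfl⟩ := hfr
          rw [elapsed_floor hs (NNReal.coe_nonneg _)]
          rw [← hfr.2, elapsed_floor hs (NNReal.coe_nonneg _), hfr.2] at ih
          push_cast
          linarith
        · simp at *
        · push_cast
          rw [add_zero]
          exact ih.trans (elapsed_mono s q (by linarith))
    · simp only [hw, Ne.symm hw, false_and, and_false, if_false, add_zero]
      refine ih.trans (elapsed_mono s q ?_)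
      split_ifs
      · exact le_rfl
      · exact_mod_cast hmono

lemma windowCount_le_floor (hτ : ∀ w, 0 < τ w) {s : ℝ} (hs : 0 < s) (k : ℕ) (w : Fin n) (q : ℕ) :
    windowCount A τ f ξ s k w q ≤ ⌊s / τ w⌋₊ := by
  refine Nat.le_floor ?_
  rw [le_div_iff₀ (hτ w)]
  exact (windowCount_mul_le_elapsed A τ f ξ hτ hs k w q).trans (elapsed_le hs.le q _)

lemma iterTime_mono : Monotone (iterTime A τ f ξ) :=
  monotone_nat_of_le_succ (iterTime_le_succ A τ f ξ)

/-- Double counting of the fresh gradients: by summand on the left, by worker and window on the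
right. -/
lemma sum_freshCount_le (hτ : ∀ w, 0 < τ w) {s : ℝ} (hs : 0 < s) (k : ℕ) :
    ∑ b, freshCount A τ f ξ s k b ≤
      (⌊(iterTime A τ f ξ k : ℝ) / s⌋₊ + 1) * ∑ w, ⌊s / τ w⌋₊ := by
  classical
  set R := (Finset.range k).filter fun i => Fresh A τ f ξ s i with hR
  set Q := ⌊(iterTime A τ f ξ k : ℝ) / s⌋₊ with hQ
  have h1 : ∑ b, freshCount A τ f ξ s k b = R.card := by
    rw [Finset.card_eq_sum_card_fiberwise (f := ξ) (t := Finset.univ)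
      (fun _ _ => Finset.mem_coe.2 (Finset.mem_univ _))]
    simp only [freshCount, hR, Finset.filter_filter]
  have h2 : R.card = ∑ p ∈ (Finset.univ : Finset (Fin n)) ×ˢ Finset.range (Q + 1),
      windowCount A τ f ξ s k p.1 p.2 := by
    rw [Finset.card_eq_sum_card_fiberwise
      (f := fun i => (iterWorker A τ f ξ i, ⌊(iterTime A τ f ξ (i + 1) : ℝ) / s⌋₊))
      (t := Finset.univ ×ˢ Finset.range (Q + 1))]
    · simp only [windowCount, hR, Finset.filter_filter, Prod.ext_iff]
    · intro i hi
      have hi : i + 1 ≤ k := by simpa [hR] using (Finset.mem_filter.1 (Finset.mem_coe.1 hi)).1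
      have := iterTime_mono A τ f ξ hi
      simp only [Finset.coe_product, Finset.coe_univ, Finset.coe_range, Set.mem_prod, Set.mem_univ,
        true_and, Set.mem_Iio, Nat.lt_succ_iff, hQ]
      gcongr
  rw [h1, h2, Finset.sum_product]
  calc _ ≤ ∑ w : Fin n, ∑ _q ∈ Finset.range (Q + 1), ⌊s / τ w⌋₊ :=
        Finset.sum_le_sum fun w _ => Finset.sum_le_sum fun q _ =>
          windowCount_le_floor A τ f ξ hτ hs k w q
    _ = _ := by simp [Finset.mul_sum]

/-- Up to time `t`, at least half of the blocks are incomplete. -/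
theorem card_incomplete {T : ℕ} {e : Fin m × Fin T ≃ Fin d} (hf : ZeroChain e f)
    (hτ : ∀ w, 0 < τ w) {s t : ℝ} (hs : 0 < s) (hsm : 3 * ∑ w, ⌊s / τ w⌋₊ ≤ m)
    (l : Fin T) (hl : (l : ℕ) + 1 = T) (hT : 8 * ⌊t / s⌋₊ + 2 ≤ 3 * T) (k : ℕ)
    (hk : (iterTime A τ f ξ k : ℝ) ≤ t) :
    m ≤ 2 * (Finset.univ.filter fun b => iterPoint A τ f ξ k (e (b, l)) = 0).card := by
  classical
  set Q := ⌊(iterTime A τ f ξ k : ℝ) / s⌋₊ with hQ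
  have hQt : Q ≤ ⌊t / s⌋₊ := Nat.floor_le_floor (div_le_div_of_nonneg_right hk hs.le)
  set D := Finset.univ.filter fun b => ¬ iterPoint A τ f ξ k (e (b, l)) = 0 with hD
  have hsplit := Finset.card_filter_add_card_filter_not (s := (Finset.univ : Finset (Fin m)))
    (fun b => iterPoint A τ f ξ k (e (b, l)) = 0)
  rw [Finset.card_univ, Fintype.card_fin, ← hD] at hsplit
  have hfr := sum_freshCount_le A τ f ξ hτ hs k
  rw [← hQ] at hfr
  have h1 : D.card * T ≤ ∑ b, (freshCount A τ f ξ s k b + Q) := by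
    calc D.card * T = ∑ b ∈ D, T := by simp
      _ ≤ ∑ b ∈ D, (freshCount A τ f ξ s k b + Q) := by
        refine Finset.sum_le_sum fun b hb => ?_
        have := iterPoint_lt A τ f ξ e k _ (support_invariant A τ f ξ hf hτ hs k).1 b l
          (Finset.mem_filter.1 hb).2
        omega
      _ ≤ _ := Finset.sum_le_sum_of_subset (Finset.subset_univ _)
  rw [Finset.sum_add_distrib, Finset.sum_const, Finset.card_univ, Fintype.card_fin,
    smul_eq_mul] at h1
  -- Each completed block needs `T` units of progress; the supply is at most `(Q + 1) * m / 3` fresh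
  -- units and `m * Q` stale ones. With `8 * Q + 2 ≤ 3 * T` this leaves at most `m / 2` completed
  -- blocks.
  have h2 : 3 * (D.card * T) ≤ m * (4 * Q + 1) := by
    calc 3 * (D.card * T) ≤ 3 * ((Q + 1) * ∑ w, ⌊s / τ w⌋₊ + m * Q) := by omega
      _ = (Q + 1) * (3 * ∑ w, ⌊s / τ w⌋₊) + 3 * (m * Q) := by ring
      _ ≤ (Q + 1) * m + 3 * (m * Q) := by gcongr
      _ = _ := by ring
  have h3 : 6 * D.card * T ≤ m * (3 * T) := by
    calc 6 * D.card * T = 2 * (3 * (D.card * T)) := by ring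
      _ ≤ 2 * (m * (4 * Q + 1)) := by omega
      _ = m * (8 * Q + 2) := by ring
      _ ≤ m * (3 * T) := by gcongr; omega
  have h4 : 2 * D.card ≤ m := by
    have hT0 : 0 < T := by omega
    refine Nat.le_of_mul_le_mul_right ?_ (Nat.mul_pos three_pos hT0)
    calc _ = 6 * D.card * T := by ring
      _ ≤ _ := h3
  omega

end Trajectory

/-! ### The equilibrium time and the number of gradients per window. -/

lemma exists_equilibriumTime_eq {n : ℕ} (hn : 0 < n) (τ : Fin n → ℝ) (S : ℝ) :
    ∃ j : Fin n, equilibriumTime τ S = (∑ i ∈ Finset.Iic j, 1 / τ i)⁻¹ * (S + ((j : ℕ) + 1)) := by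
  have : Nonempty (Fin n) := ⟨⟨0, hn⟩⟩
  obtain ⟨j, hj⟩ := exists_eq_ciInf_of_finite
    (f := fun j : Fin n => (∑ i ∈ Finset.Iic j, 1 / τ i)⁻¹ * (S + ((j : ℕ) + 1)))
  exact ⟨j, hj.symm⟩

lemma sum_one_div_pos {n : ℕ} {τ : Fin n → ℝ} (hτ : ∀ i, 0 < τ i) (j : Fin n) :
    0 < ∑ i ∈ Finset.Iic j, 1 / τ i :=
  Finset.sum_pos (fun i _ => one_div_pos.2 (hτ i)) ⟨j, Finset.mem_Iic.2 le_rfl⟩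

lemma equilibriumTime_pos {n : ℕ} (hn : 0 < n) {τ : Fin n → ℝ} (hτ : ∀ i, 0 < τ i) (m : ℕ) :
    0 < equilibriumTime τ m := by
  obtain ⟨j, hj⟩ := exists_equilibriumTime_eq hn τ m
  rw [hj]
  exact mul_pos (inv_pos.2 (sum_one_div_pos hτ j)) (by positivity)

/-- In a quarter of the equilibrium time the workers compute at most `m / 3` gradients. -/
lemma three_mul_sum_floor_le {n : ℕ} (hn : 0 < n) {τ : Fin n → ℝ} (hτ : ∀ i, 0 < τ i)
    (hmono : Monotone τ) (m : ℕ) :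
    3 * ∑ w, ⌊equilibriumTime τ m / 4 / τ w⌋₊ ≤ m := by
  classical
  set s := equilibriumTime τ m / 4 with hs
  set W := Finset.univ.filter fun w => τ w ≤ s with hW
  have hs0 : 0 < s := div_pos (equilibriumTime_pos hn hτ m) four_pos
  have hout : ∀ w ∈ Finset.univ, w ∉ W → ⌊s / τ w⌋₊ = 0 := by
    intro w _ hw
    have : s < τ w := by simpa [hW] using hw
    exact Nat.floor_eq_zero.2 ((div_lt_one (hτ w)).2 this)
  rw [← Finset.sum_subset (Finset.subset_univ W) hout]
  rcases W.eq_empty_or_nonempty with h | hne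
  · simp [h]
  set j := W.max' hne
  have hjW : j ∈ W := Finset.max'_mem _ _
  have hWI : W = Finset.Iic j := by
    ext w
    refine ⟨fun h => Finset.mem_Iic.2 (Finset.le_max' _ _ h), fun h => ?_⟩
    exact Finset.mem_filter.2 ⟨Finset.mem_univ _,
      (hmono (Finset.mem_Iic.1 h)).trans (Finset.mem_filter.1 hjW).2⟩
  set M := ∑ w ∈ W, ⌊s / τ w⌋₊ with hM
  -- Each worker in `W` finishes at least one gradient, so the term `j + 1` in the equilibrium time
  -- is absorbed by `M`: from `4 * M ≤ m + (j + 1) ≤ m + M` follows `3 * M ≤ m`.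
  have hjM : (j : ℕ) + 1 ≤ M := by
    calc (j : ℕ) + 1 = ∑ w ∈ W, 1 := by simp [hWI]
      _ ≤ M := Finset.sum_le_sum fun w hw =>
        Nat.le_floor (by
          rw [Nat.cast_one, one_le_div (hτ w)]
          exact (Finset.mem_filter.1 hw).2)
  have hS := sum_one_div_pos hτ j
  have hle : equilibriumTime τ m ≤ (∑ i ∈ Finset.Iic j, 1 / τ i)⁻¹ * (m + ((j : ℕ) + 1)) :=
    ciInf_le (Set.finite_range _).bddBelow j
  rw [inv_mul_eq_div, le_div_iff₀ hS] at hle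
  have hMle : (M : ℝ) ≤ s * ∑ i ∈ Finset.Iic j, 1 / τ i := by
    rw [hM, Nat.cast_sum, Finset.mul_sum, hWI]
    refine Finset.sum_le_sum fun w _ => ?_
    rw [mul_one_div]
    exact Nat.floor_le (div_nonneg hs0.le (hτ w).le)
  have hjM' : ((j : ℕ) : ℝ) + 1 ≤ M := by exact_mod_cast hjM
  have : (3 : ℝ) * M ≤ m := by
    rw [hs] at hMle
    linarith
  exact_mod_cast this

/-! ### Scalar building blocks and their Lipschitz bounds. -/

section Scalar

/-- A smooth function that is flat at `0` and bounded away from `0` on `[1, ∞)`. -/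
noncomputable def bump (a : ℝ) : ℝ := 1 - (1 + a ^ 2)⁻¹

/-- The derivative of `bump`. -/
noncomputable def bumpDeriv (a : ℝ) : ℝ := 2 * a * ((1 + a ^ 2)⁻¹) ^ 2

/-- A bounded positive increasing function. -/
noncomputable def ramp (b : ℝ) : ℝ := Real.arctan b + 2

/-- A quadratic penalty on the negative half-line. -/
noncomputable def wall (b : ℝ) : ℝ := 9 / 2 * (min b 0) ^ 2

lemma hasDerivAt_ramp (b : ℝ) : HasDerivAt ramp (1 + b ^ 2)⁻¹ b :=
  (Real.hasDerivAt_arctan' b).add_const 2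

lemma hasDerivAt_bump (a : ℝ) : HasDerivAt bump (bumpDeriv a) a := by
  have h0 : (1 + a ^ 2) ≠ 0 := by positivity
  have h : HasDerivAt (fun a : ℝ => 1 + a ^ 2) (2 * a) a := by
    simpa using (hasDerivAt_pow 2 a).const_add 1
  refine ((h.inv h0).const_sub 1).congr_deriv ?_
  unfold bumpDeriv
  field_simp

/-- The first-order remainder is at most `9 / 2 * (c - b) ^ 2` in every sign case, so the kink of
`min` at `0` needs no separate treatment. -/
lemma hasDerivAt_wall (b : ℝ) : HasDerivAt wall (9 * min b 0) b := by
  have key : ∀ c, |wall c - wall b - (c - b) * (9 * min b 0)| ≤ 9 / 2 * (c - b) ^ 2 := by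
    intro c
    unfold wall
    rw [abs_le]
    rcases le_total b 0 with hb | hb <;> rcases le_total c 0 with hc | hc <;>
      simp only [min_eq_left, min_eq_right, hb, hc] <;> constructor <;>
      nlinarith [mul_nonneg_of_nonpos_of_nonpos (a := b) (b := min b 0)]
  rw [hasDerivAt_iff_isLittleO]
  refine Asymptotics.IsBigO.trans_isLittleO (g := fun c => (c - b) ^ 2) ?_ ?_
  · refine Asymptotics.IsBigO.of_bound (9 / 2) (Filter.Eventually.of_forall fun c => ?_)
    simpa using key c
  · simpa using (Asymptotics.isLittleO_pow_sub_sub b one_lt_two)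

lemma inv_one_add_sq_le_one (a : ℝ) : (1 + a ^ 2)⁻¹ ≤ 1 :=
  inv_le_one_of_one_le₀ (by nlinarith [sq_nonneg a])

lemma bump_nonneg (a : ℝ) : 0 ≤ bump a := sub_nonneg.2 (inv_one_add_sq_le_one a)

lemma bump_le_one (a : ℝ) : bump a ≤ 1 := by
  have : 0 ≤ (1 + a ^ 2)⁻¹ := by positivity
  unfold bump
  linarith

lemma half_le_bump {a : ℝ} (ha : 1 ≤ a) : 1 / 2 ≤ bump a := by
  have : (1 + a ^ 2)⁻¹ ≤ 2⁻¹ := inv_anti₀ two_pos (by nlinarith)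
  unfold bump
  linarith

lemma bump_zero : bump 0 = 0 := by simp [bump]

lemma bumpDeriv_zero : bumpDeriv 0 = 0 := by simp [bumpDeriv]

lemma ramp_pos (b : ℝ) : 0 < ramp b := by
  have := Real.neg_pi_div_two_lt_arctan b
  have := Real.pi_lt_four
  unfold ramp
  linarith

lemma ramp_le_four (b : ℝ) : ramp b ≤ 4 := by
  have := Real.arctan_lt_pi_div_two b
  have := Real.pi_lt_four
  unfold ramp
  linarith

lemma wall_nonneg (b : ℝ) : 0 ≤ wall b := by
  unfold wall
  positivity

lemma abs_inv_sub_inv_le (a b : ℝ) : |(1 + a ^ 2)⁻¹ - (1 + b ^ 2)⁻¹| ≤ |a - b| := by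
  have ha : 0 < 1 + a ^ 2 := by positivity
  have hb : 0 < 1 + b ^ 2 := by positivity
  rw [inv_sub_inv ha.ne' hb.ne', abs_div, abs_of_pos (mul_pos ha hb), div_le_iff₀ (mul_pos ha hb)]
  rw [show 1 + b ^ 2 - (1 + a ^ 2) = (a - b) * (-(a + b)) by ring, abs_mul]
  refine mul_le_mul_of_nonneg_left ?_ (abs_nonneg _)
  rw [abs_neg, abs_le]
  constructor <;> nlinarith [sq_nonneg (a * b), sq_nonneg (a + 1), sq_nonneg (b + 1),
    sq_nonneg (a - 1), sq_nonneg (b - 1)]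

lemma abs_bump_sub_le (a b : ℝ) : |bump a - bump b| ≤ |a - b| := by
  have := abs_inv_sub_inv_le b a
  rw [abs_sub_comm b a] at this
  unfold bump
  convert this using 2
  ring

lemma abs_ramp_sub_le (a b : ℝ) : |ramp a - ramp b| ≤ |a - b| := by
  have := Convex.norm_image_sub_le_of_norm_hasDerivWithin_le (s := Set.univ) (C := 1)
    (fun x _ => (hasDerivAt_ramp x).hasDerivWithinAt) (fun x _ => by
      rw [Real.norm_of_nonneg (by positivity)]
      exact inv_one_add_sq_le_one x) convex_univ (Set.mem_univ b) (Set.mem_univ a)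
  simpa using this

lemma abs_mul_sub_mul_le (p q p' q' : ℝ) :
    |p * q - p' * q'| ≤ |p - p'| * |q| + |p'| * |q - q'| := by
  rw [← abs_mul, ← abs_mul, show p * q - p' * q' = (p - p') * q + p' * (q - q') by ring]
  exact abs_add_le _ _

lemma abs_inv_le_one (a : ℝ) : |(1 + a ^ 2)⁻¹| ≤ 1 := by
  rw [abs_of_nonneg (by positivity)]
  exact inv_one_add_sq_le_one a

lemma abs_mul_inv_le (a : ℝ) : |a * (1 + a ^ 2)⁻¹| ≤ 1 / 2 := by
  have ha : 0 < 1 + a ^ 2 := by positivity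
  rw [← div_eq_mul_inv, abs_div, abs_of_pos ha, div_le_iff₀ ha, abs_le]
  constructor <;> nlinarith [sq_nonneg (a + 1), sq_nonneg (a - 1)]

lemma abs_mul_inv_sub_le (a b : ℝ) : |a * (1 + a ^ 2)⁻¹ - b * (1 + b ^ 2)⁻¹| ≤ |a - b| := by
  have ha : 0 < 1 + a ^ 2 := by positivity
  have hb : 0 < 1 + b ^ 2 := by positivity
  rw [← div_eq_mul_inv, ← div_eq_mul_inv, div_sub_div _ _ ha.ne' hb.ne', abs_div,
    abs_of_pos (mul_pos ha hb), div_le_iff₀ (mul_pos ha hb)]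
  rw [show a * (1 + b ^ 2) - (1 + a ^ 2) * b = (a - b) * (1 - a * b) by ring, abs_mul]
  refine mul_le_mul_of_nonneg_left ?_ (abs_nonneg _)
  rw [abs_le]
  constructor <;> nlinarith [sq_nonneg (a * b), sq_nonneg (a + b), sq_nonneg (a - b)]

lemma bumpDeriv_eq (a : ℝ) : bumpDeriv a = 2 * ((a * (1 + a ^ 2)⁻¹) * (1 + a ^ 2)⁻¹) := by
  unfold bumpDeriv
  ring

lemma abs_bumpDeriv_le (a : ℝ) : |bumpDeriv a| ≤ 1 := by
  have h1 := abs_mul_inv_le a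
  have h2 := abs_inv_le_one a
  rw [bumpDeriv_eq, abs_mul, abs_two, abs_mul]
  nlinarith [abs_nonneg (a * (1 + a ^ 2)⁻¹), abs_nonneg ((1 + a ^ 2)⁻¹)]

lemma abs_bumpDeriv_le_two_mul (a : ℝ) : |bumpDeriv a| ≤ 2 * |a| := by
  have h2 := abs_inv_le_one a
  unfold bumpDeriv
  rw [abs_mul, abs_mul, abs_two, abs_pow]
  have : |(1 + a ^ 2)⁻¹| ^ 2 ≤ 1 := pow_le_one₀ (abs_nonneg _) h2
  nlinarith [abs_nonneg a]

lemma abs_bumpDeriv_sub_le (a b : ℝ) : |bumpDeriv a - bumpDeriv b| ≤ 3 * |a - b| := by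
  have h := abs_mul_sub_mul_le (a * (1 + a ^ 2)⁻¹) (1 + a ^ 2)⁻¹ (b * (1 + b ^ 2)⁻¹) (1 + b ^ 2)⁻¹
  have h1 := abs_mul_inv_sub_le a b
  have h2 := abs_inv_le_one a
  have h3 := abs_mul_inv_le b
  have h4 := abs_inv_sub_inv_le a b
  have h5 := mul_le_mul h1 h2 (abs_nonneg _) (abs_nonneg _)
  have h6 := mul_le_mul h3 h4 (abs_nonneg _) (by norm_num)
  rw [bumpDeriv_eq, bumpDeriv_eq, ← mul_sub, abs_mul, abs_two]
  linarith

lemma abs_min_sub_min_le (a b : ℝ) : |min a 0 - min b 0| ≤ |a - b| := by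
  simpa using abs_min_sub_min_le_max a 0 b 0

end Scalar

/-! ### The chain function of a single block. -/

section ChainFunction

/-- The value of the chain function at the coordinate sequence `u`. -/
noncomputable def chainValue (T : ℕ) (u : ℕ → ℝ) : ℝ :=
  ∑ k ∈ Finset.range (T + 1), (wall (u (k + 1)) - bump (u k) * ramp (u (k + 1)))

/-- The partial derivative of the chain function in the coordinate `u (i + 1)`. -/
noncomputable def chainSlope (u : ℕ → ℝ) (i : ℕ) : ℝ :=
  9 * min (u (i + 1)) 0 - bump (u i) * (1 + u (i + 1) ^ 2)⁻¹ -
    bumpDeriv (u (i + 1)) * ramp (u (i + 2))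

lemma neg_le_chainValue (T : ℕ) (u : ℕ → ℝ) : -(4 * ((T : ℝ) + 1)) ≤ chainValue T u := by
  calc -(4 * ((T : ℝ) + 1)) = ∑ _k ∈ Finset.range (T + 1), (-4 : ℝ) := by
        simp
        ring
    _ ≤ chainValue T u := Finset.sum_le_sum fun k _ => by
        have h1 := wall_nonneg (u (k + 1))
        have h2 := mul_le_mul (bump_le_one (u k)) (ramp_le_four (u (k + 1)))
          (ramp_pos _).le one_pos.le
        linarith

lemma chainValue_nonpos {T : ℕ} {u : ℕ → ℝ} (hu : ∀ k, u (k + 1) = 0) : chainValue T u ≤ 0 := by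
  refine Finset.sum_nonpos fun k _ => ?_
  have := mul_nonneg (bump_nonneg (u k)) (ramp_pos (u (k + 1))).le
  have h0 : wall (u (k + 1)) = 0 := by simp [hu, wall]
  linarith

/-- `bump` vanishes to second order at `0`, which removes the influence of both neighbours; this is
the source of the zero-chain property. -/
lemma chainSlope_eq_zero {u : ℕ → ℝ} {i : ℕ} (h1 : u i = 0) (h2 : u (i + 1) = 0) :
    chainSlope u i = 0 := by
  simp [chainSlope, h1, h2, bump_zero, bumpDeriv_zero]

/-- For `|b| ≤ 1` the product of `bump a` and the slope of `ramp` is at least `1 / 4`. For negative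
`b` the term with `bumpDeriv b` has the wrong sign but size at most `8 * |b|`, and the slope `9 * b`
of `wall` outweighs it; for `b ≤ -1` the surplus alone suffices. -/
lemma chainSlope_le {u : ℕ → ℝ} {i : ℕ} (h1 : 1 ≤ u i) (h2 : u (i + 1) < 1) :
    chainSlope u i ≤ -(1 / 4) := by
  unfold chainSlope
  generalize u i = a at *
  generalize u (i + 1) = b at *
  generalize u (i + 2) = c at *
  have hb0 : 0 < (1 + b ^ 2)⁻¹ := by positivity
  have ha := half_le_bump h1
  have hr0 := ramp_pos c
  have hr4 := ramp_le_four c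
  have key : -1 ≤ b → 1 / 4 ≤ bump a * (1 + b ^ 2)⁻¹ := fun hb => by
    have : (2 : ℝ)⁻¹ ≤ (1 + b ^ 2)⁻¹ := inv_anti₀ (by positivity) (by nlinarith)
    nlinarith
  rcases le_total 0 b with hb | hb
  · have : 0 ≤ bumpDeriv b * ramp c := mul_nonneg (by unfold bumpDeriv; positivity) hr0.le
    rw [min_eq_right hb]
    linarith [key (by linarith)]
  · have h3 : -(bumpDeriv b * ramp c) ≤ -(8 * b) := by
      have h4 := abs_bumpDeriv_le_two_mul b
      rw [abs_of_nonpos hb] at h4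
      have h5 := mul_le_mul h4 hr4 hr0.le (by linarith)
      have h6 := mul_le_mul_of_nonneg_right (neg_le_abs (bumpDeriv b)) hr0.le
      linarith
    rw [min_eq_left hb]
    rcases le_total (-1) b with hb1 | hb1
    · linarith [key hb1]
    · nlinarith [mul_nonneg (bump_nonneg a) hb0.le]

/-- The sequence starts at `1` and ends at `0`; the step at which it first drops below `1` has a
steep slope. -/
lemma exists_chainSlope_le {u : ℕ → ℝ} {T : ℕ} (h0 : u 0 = 1) (hT : u T = 0) :
    ∃ i < T, chainSlope u i ≤ -(1 / 4) := by
  classical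
  have hex : ∃ k, u k < 1 := ⟨T, by rw [hT]; exact one_pos⟩
  have hne : Nat.find hex ≠ 0 := fun h => by
    have := Nat.find_spec hex
    rw [h, h0] at this
    exact lt_irrefl _ this
  obtain ⟨i, hi⟩ := Nat.exists_eq_succ_of_ne_zero hne
  have hspec := Nat.find_spec hex
  have hle : Nat.find hex ≤ T := Nat.find_min' hex (by rw [hT]; exact one_pos)
  have hmin : 1 ≤ u i := not_lt.1 (Nat.find_min hex (by omega))
  rw [hi] at hspec
  exact ⟨i, by omega, chainSlope_le hmin hspec⟩

lemma abs_chainSlope_sub_le (u v : ℕ → ℝ) (i : ℕ) :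
    |chainSlope u i - chainSlope v i| ≤
      |u i - v i| + 22 * |u (i + 1) - v (i + 1)| + |u (i + 2) - v (i + 2)| := by
  unfold chainSlope
  generalize u i = a
  generalize u (i + 1) = b
  generalize u (i + 2) = c
  generalize v i = a'
  generalize v (i + 1) = b'
  generalize v (i + 2) = c'
  have h1 := abs_mul_sub_mul_le (bump a) (1 + b ^ 2)⁻¹ (bump a') (1 + b' ^ 2)⁻¹
  have h2 := abs_mul_sub_mul_le (bumpDeriv b) (ramp c) (bumpDeriv b') (ramp c')
  have h3 := abs_min_sub_min_le b b'
  have h4 := mul_le_mul (abs_bump_sub_le a a') (abs_inv_le_one b) (abs_nonneg _) (abs_nonneg _)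
  have h5 : |bump a'| * |(1 + b ^ 2)⁻¹ - (1 + b' ^ 2)⁻¹| ≤ 1 * |b - b'| :=
    mul_le_mul (by rw [abs_of_nonneg (bump_nonneg _)]; exact bump_le_one _)
      (abs_inv_sub_inv_le b b') (abs_nonneg _) one_pos.le
  have h6 : |bumpDeriv b - bumpDeriv b'| * |ramp c| ≤ 3 * |b - b'| * 4 :=
    mul_le_mul (abs_bumpDeriv_sub_le b b')
      (by rw [abs_of_pos (ramp_pos c)]; exact ramp_le_four c) (abs_nonneg _) (by positivity)
  have h7 := mul_le_mul (abs_bumpDeriv_le b') (abs_ramp_sub_le c c') (abs_nonneg _) one_pos.le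
  have h8 : ∀ p q r p' q' r' : ℝ, |9 * p - q - r - (9 * p' - q' - r')| ≤
      9 * |p - p'| + |q - q'| + |r - r'| := by
    intro p q r p' q' r'
    rw [show 9 * p - q - r - (9 * p' - q' - r') = 9 * (p - p') - (q - q') - (r - r') by ring]
    refine (abs_sub _ _).trans (add_le_add_left ((abs_sub _ _).trans ?_) _)
    rw [abs_mul, abs_of_pos (by norm_num : (0 : ℝ) < 9)]
  refine (h8 _ _ _ _ _ _).trans ?_
  linarith

/-- The Hessian is morally tridiagonal with row sums at most `1 + 22 + 1 = 24`. Equal boundary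
values let the shifted sums be bounded by the central one, so the constant does not depend on `T`.
-/
lemma sum_chainSlope_sub_sq_le {T : ℕ} {u v : ℕ → ℝ} (h0 : u 0 = v 0)
    (hT : u (T + 1) = v (T + 1)) :
    ∑ i ∈ Finset.range T, (chainSlope u i - chainSlope v i) ^ 2 ≤
      24 ^ 2 * ∑ i ∈ Finset.range T, (u (i + 1) - v (i + 1)) ^ 2 := by
  set D : ℕ → ℝ := fun i => (u i - v i) ^ 2 with hD
  -- Cauchy–Schwarz with weights `1, 22, 1`.
  have hpt : ∀ i, (chainSlope u i - chainSlope v i) ^ 2 ≤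
      24 * (D i + 22 * D (i + 1) + D (i + 2)) := by
    intro i
    have h := abs_chainSlope_sub_le u v i
    rw [← sq_abs]
    simp only [hD]
    rw [← sq_abs (u i - v i), ← sq_abs (u (i + 1) - v (i + 1)), ← sq_abs (u (i + 2) - v (i + 2))]
    set p := |u i - v i|
    set q := |u (i + 1) - v (i + 1)|
    set r := |u (i + 2) - v (i + 2)|
    refine (pow_le_pow_left₀ (abs_nonneg _) h 2).trans ?_
    nlinarith [sq_nonneg (p - q), sq_nonneg (q - r), sq_nonneg (p - r)]
  have hD0 : D 0 = 0 := by simp [hD, h0]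
  have hDT : D (T + 1) = 0 := by simp [hD, hT]
  have hDn : ∀ i, 0 ≤ D i := fun i => sq_nonneg _
  have s0 : ∑ i ∈ Finset.range T, D i ≤ ∑ i ∈ Finset.range T, D (i + 1) := by
    have e1 := Finset.sum_range_succ D T
    have e2 := Finset.sum_range_succ' D T
    linarith [hDn T]
  have s2 : ∑ i ∈ Finset.range T, D (i + 2) ≤ ∑ i ∈ Finset.range T, D (i + 1) := by
    have e1 := Finset.sum_range_succ (fun i => D (i + 1)) T
    have e2 := Finset.sum_range_succ' (fun i => D (i + 1)) T
    simp only [zero_add, add_assoc, one_add_one_eq_two] at e1 e2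
    linarith [hDn 1]
  calc _ ≤ ∑ i ∈ Finset.range T, 24 * (D i + 22 * D (i + 1) + D (i + 2)) :=
        Finset.sum_le_sum fun i _ => hpt i
    _ = 24 * (∑ i ∈ Finset.range T, D i + 22 * ∑ i ∈ Finset.range T, D (i + 1) +
          ∑ i ∈ Finset.range T, D (i + 2)) := by
        rw [← Finset.mul_sum, Finset.sum_add_distrib, Finset.sum_add_distrib, Finset.mul_sum]
    _ ≤ 24 ^ 2 * ∑ i ∈ Finset.range T, D (i + 1) := by linarith

end ChainFunction

/-! ### Gradients and norms in block coordinates. -/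

lemma gradient_apply {d : ℕ} {f : Vec d → ℝ} {f' : Vec d →L[ℝ] ℝ} {x : Vec d}
    (hf : HasFDerivAt f f' x) (j : Fin d) :
    gradient f x j = f' (EuclideanSpace.single j 1) := by
  rw [← hf.fderiv, ← inner_gradient_left, EuclideanSpace.inner_single_right]
  simp

lemma norm_sq_eq_sum_blocks {m d T : ℕ} (e : Fin m × Fin T ≃ Fin d) (x : Vec d) :
    ‖x‖ ^ 2 = ∑ b, ∑ i, x (e (b, i)) ^ 2 := by
  rw [EuclideanSpace.norm_sq_eq, ← Equiv.sum_comp e, Fintype.sum_prod_type]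
  simp

lemma gradient_avg_apply {m d : ℕ} {f : Fin m → Vec d → ℝ} (hf : ∀ i, Differentiable ℝ (f i))
    (x : Vec d) (j : Fin d) :
    gradient (avg f) x j = (1 / (m : ℝ)) * ∑ i, gradient (f i) x j := by
  have h : HasFDerivAt (avg f) ((1 / (m : ℝ)) • ∑ i, fderiv ℝ (f i) x) x :=
    (HasFDerivAt.fun_sum fun i _ => (hf i x).hasFDerivAt).const_mul _
  rw [gradient_apply h]
  simp [fun i => gradient_apply (hf i x).hasFDerivAt j]

/-! ### Scaled chains on disjoint blocks. -/

section BlockChain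

variable {m d T : ℕ} (e : Fin m × Fin T ≃ Fin d) (r : ℝ)

/-- The scaled coordinates of the `b`-th block, preceded by `1` and followed by zeros. -/
noncomputable def blockCoord (b : Fin m) (x : Vec d) : ℕ → ℝ
  | 0 => 1
  | k + 1 => if h : k < T then x (e (b, ⟨k, h⟩)) / r else 0

/-- The derivative of `blockCoord`. -/
noncomputable def blockCoordDeriv (b : Fin m) : ℕ → (Vec d →L[ℝ] ℝ)
  | 0 => 0
  | k + 1 => if h : k < T then r⁻¹ • EuclideanSpace.proj (e (b, ⟨k, h⟩)) else 0

/-- The chain function on the `b`-th block. -/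
noncomputable def blockChain (a : ℝ) (b : Fin m) (x : Vec d) : ℝ :=
  a * chainValue T (blockCoord e r b x)

lemma hasFDerivAt_blockCoord (b : Fin m) (k : ℕ) (x : Vec d) :
    HasFDerivAt (fun x => blockCoord e r b x k) (blockCoordDeriv e r b k) x := by
  rcases k with _ | k
  · exact hasFDerivAt_const _ _
  · simp only [blockCoord, blockCoordDeriv]
    split_ifs with h
    · have := (EuclideanSpace.proj (𝕜 := ℝ) (e (b, ⟨k, h⟩)) : Vec d →L[ℝ] ℝ).hasFDerivAt (x := x)
      simp only [div_eq_inv_mul]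
      exact this.const_mul r⁻¹
    · exact hasFDerivAt_const _ _

lemma blockCoordDeriv_single (b b' : Fin m) (k : ℕ) (i : Fin T) :
    blockCoordDeriv e r b k (EuclideanSpace.single (e (b', i)) 1) =
      if k = i + 1 then (if b' = b then r⁻¹ else 0) else 0 := by
  rcases k with _ | k
  · simp [blockCoordDeriv]
  · simp only [blockCoordDeriv, add_left_inj]
    by_cases hk : k = i
    · subst hk
      by_cases hb : b' = b
      · simp [hb]
      · simp [hb, Ne.symm hb]
    · have : ∀ h : k < T, ¬ (b = b' ∧ (⟨k, h⟩ : Fin T) = i) := fun h h' =>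
        hk (congrArg Fin.val h'.2)
      split_ifs with h <;> simp [this]

lemma hasFDerivAt_blockChain (a : ℝ) (b : Fin m) (x : Vec d) :
    HasFDerivAt (blockChain e r a b)
      (a • ∑ k ∈ Finset.range (T + 1),
        ((9 * min (blockCoord e r b x (k + 1)) 0) • blockCoordDeriv e r b (k + 1) -
          (bump (blockCoord e r b x k) •
            ((1 + blockCoord e r b x (k + 1) ^ 2)⁻¹ • blockCoordDeriv e r b (k + 1)) +
          ramp (blockCoord e r b x (k + 1)) •
            (bumpDeriv (blockCoord e r b x k) • blockCoordDeriv e r b k)))) x := by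
  have hu := fun k => hasFDerivAt_blockCoord e r b k x
  refine (HasFDerivAt.fun_sum fun k _ => ?_).const_mul a
  exact ((hasDerivAt_wall _).comp_hasFDerivAt x (hu (k + 1))).sub
    (((hasDerivAt_bump _).comp_hasFDerivAt x (hu k)).mul
      ((hasDerivAt_ramp _).comp_hasFDerivAt x (hu (k + 1))))

lemma differentiable_blockChain (a : ℝ) (b : Fin m) : Differentiable ℝ (blockChain e r a b) :=
  fun x => (hasFDerivAt_blockChain e r a b x).differentiableAt

lemma gradient_blockChain (a : ℝ) (b b' : Fin m) (x : Vec d) (i : Fin T) :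
    gradient (blockChain e r a b) x (e (b', i)) =
      if b' = b then a / r * chainSlope (blockCoord e r b x) i else 0 := by
  rw [gradient_apply (hasFDerivAt_blockChain e r a b x)]
  simp only [smul_apply, sum_apply, sub_apply, add_apply,
    blockCoordDeriv_single, smul_eq_mul, Finset.sum_sub_distrib, Finset.sum_add_distrib,
    add_left_inj, mul_ite, mul_zero, Finset.sum_ite_eq', Finset.mem_range]
  have h1 : (i : ℕ) < T + 1 := by omega
  have h2 : (i : ℕ) + 1 < T + 1 := by omega
  by_cases hb : b' = b
  · simp only [h1, h2, hb, if_true, chainSlope]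
    ring
  · simp [hb]

lemma zeroChain_blockChain (a : ℝ) : ZeroChain e (blockChain e r a) := by
  intro j x p hx b i hne
  rw [gradient_blockChain] at hne
  by_cases hb : b = j
  · subst hb
    rw [if_pos rfl]
    by_contra hlt
    have hz : ∀ k : Fin T, p b ≤ k → blockCoord e r b x (k + 1) = 0 := by
      intro k hk
      have : x (e (b, k)) = 0 := by
        by_contra h
        have := hx b k h
        omega
      simp [blockCoord, this]
    refine hne ?_
    rw [if_pos rfl, chainSlope_eq_zero _ (hz i (by omega)), mul_zero]
    obtain ⟨i, hi⟩ := i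
    rcases i with _ | i
    · simp at hlt
    · exact hz ⟨i, by omega⟩ (by simp at hlt ⊢; omega)
  · simp [hb] at hne

lemma sum_sq_blockCoord_sub (b : Fin m) (x y : Vec d) :
    ∑ i ∈ Finset.range T, (blockCoord e r b x (i + 1) - blockCoord e r b y (i + 1)) ^ 2 =
      (r⁻¹) ^ 2 * ∑ i, (x - y) (e (b, i)) ^ 2 := by
  rw [Finset.sum_range, Finset.mul_sum]
  refine Finset.sum_congr rfl fun i _ => ?_
  simp [blockCoord]
  ring

lemma norm_gradient_blockChain_sub_sq_le (a : ℝ) (b : Fin m) (x y : Vec d) :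
    ‖gradient (blockChain e r a b) x - gradient (blockChain e r a b) y‖ ^ 2 ≤
      (24 * a / r ^ 2) ^ 2 * ∑ i, (x - y) (e (b, i)) ^ 2 := by
  rw [norm_sq_eq_sum_blocks e, Finset.sum_eq_single b]
  · simp only [PiLp.sub_apply, gradient_blockChain, if_true]
    have h := sum_chainSlope_sub_sq_le (T := T) (u := blockCoord e r b x) (v := blockCoord e r b y)
      rfl (by simp [blockCoord])
    rw [sum_sq_blockCoord_sub, Finset.sum_range] at h
    calc _ = (a / r) ^ 2 * ∑ i : Fin T,
          (chainSlope (blockCoord e r b x) i - chainSlope (blockCoord e r b y) i) ^ 2 := by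
          rw [Finset.mul_sum]
          exact Finset.sum_congr rfl fun i _ => by ring
      _ ≤ (a / r) ^ 2 * (24 ^ 2 * ((r⁻¹) ^ 2 * ∑ i, (x - y) (e (b, i)) ^ 2)) := by gcongr
      _ = _ := by
          simp only [PiLp.sub_apply]
          ring
  · intro b' _ hb'
    simp [gradient_blockChain, hb']
  · simp

/-- Each summand sees only its own block, so the squared gradient differences add up to one multiple
of `‖x - y‖ ^ 2`, and the factor `1 / m` allows the Lipschitz constant `√m * L` per block. -/
lemma functionClass_blockChain {a L δ : ℝ} (hm : 0 < m) (ha : 0 ≤ a)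
    (hδ : a * (4 * ((T : ℝ) + 1)) ≤ δ) (hL : (24 * a / r ^ 2) ^ 2 = m * L ^ 2) :
    FunctionClass δ L (blockChain e r a) where
  differentiable := differentiable_blockChain e r a
  bddBelow := by
    refine ⟨-δ, ?_⟩
    rintro _ ⟨x, rfl⟩
    exact neg_le_avg hm ha hδ x
  gap := by
    have hm' : (0 : ℝ) < m := by exact_mod_cast hm
    have h1 : avg (blockChain e r a) 0 ≤ 0 := by
      refine mul_nonpos_of_nonneg_of_nonpos (by positivity) (Finset.sum_nonpos fun b _ => ?_)
      refine mul_nonpos_of_nonneg_of_nonpos ha (chainValue_nonpos fun k => ?_)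
      simp [blockCoord]
    have h2 : -δ ≤ ⨅ x, avg (blockChain e r a) x := le_ciInf (neg_le_avg hm ha hδ)
    linarith
  smooth x y := by
    have hm' : (m : ℝ) ≠ 0 := by exact_mod_cast hm.ne'
    calc _ ≤ (1 / (m : ℝ)) * ∑ b, (24 * a / r ^ 2) ^ 2 * ∑ i, (x - y) (e (b, i)) ^ 2 := by
          gcongr with b
          exact norm_gradient_blockChain_sub_sq_le e r a b x y
      _ = L ^ 2 * ‖x - y‖ ^ 2 := by
          rw [← Finset.mul_sum, ← norm_sq_eq_sum_blocks e, hL]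
          field_simp
where
  neg_le_avg (hm : 0 < m) (ha : 0 ≤ a) (hδ : a * (4 * ((T : ℝ) + 1)) ≤ δ) (x : Vec d) :
      -δ ≤ avg (blockChain e r a) x := by
    have hm' : (m : ℝ) ≠ 0 := by exact_mod_cast hm.ne'
    calc -δ = (1 / (m : ℝ)) * ∑ _b : Fin m, -δ := by
          simp
          field_simp
      _ ≤ avg (blockChain e r a) x := by
          unfold avg
          gcongr with b
          have := mul_le_mul_of_nonneg_left (neg_le_chainValue T (blockCoord e r b x)) ha
          unfold blockChain
          linarith

/-- The gradient of the average is large as long as half of the blocks are incomplete. -/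
lemma le_norm_gradient_avg_blockChain (a : ℝ) (x : Vec d) (l : Fin T) (hl : (l : ℕ) + 1 = T)
    (hx : m ≤ 2 * (Finset.univ.filter fun b => x (e (b, l)) = 0).card) :
    a ^ 2 / (32 * m * r ^ 2) ≤ ‖gradient (avg (blockChain e r a)) x‖ ^ 2 := by
  classical
  rcases Nat.eq_zero_or_pos m with rfl | hm
  · simp
  have hm' : (0 : ℝ) < m := by exact_mod_cast hm
  set B := Finset.univ.filter fun b => x (e (b, l)) = 0 with hB
  have hcoord : ∀ b i, gradient (avg (blockChain e r a)) x (e (b, i)) =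
      a / (m * r) * chainSlope (blockCoord e r b x) i := by
    intro b i
    rw [gradient_avg_apply (differentiable_blockChain e r a)]
    simp only [gradient_blockChain, Finset.sum_ite_eq, Finset.mem_univ, if_true]
    ring
  have hblock : ∀ b ∈ B, (a / (m * r)) ^ 2 * (1 / 16) ≤
      ∑ i, gradient (avg (blockChain e r a)) x (e (b, i)) ^ 2 := by
    intro b hb
    have hb : x (e (b, l)) = 0 := (Finset.mem_filter.1 hb).2
    have h0 : blockCoord e r b x T = 0 := by
      have h1 : blockCoord e r b x (l + 1) = 0 := by simp [blockCoord, hb]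
      rwa [hl] at h1
    obtain ⟨i, hi, hs⟩ := exists_chainSlope_le (u := blockCoord e r b x) (T := T) rfl h0
    refine le_trans ?_ (Finset.single_le_sum (f := fun i =>
      gradient (avg (blockChain e r a)) x (e (b, i)) ^ 2) (fun _ _ => sq_nonneg _)
      (Finset.mem_univ (⟨i, hi⟩ : Fin T)))
    rw [hcoord, mul_pow]
    refine mul_le_mul_of_nonneg_left ?_ (sq_nonneg _)
    simp only
    nlinarith
  have hcard : (m : ℝ) ≤ 2 * B.card := by exact_mod_cast hx
  calc a ^ 2 / (32 * m * r ^ 2) = (m / 2) * ((a / (m * r)) ^ 2 * (1 / 16)) := by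
        rw [div_pow, mul_pow]
        rcases eq_or_ne r 0 with rfl | hr
        · simp
        · field_simp
          ring
    _ ≤ B.card * ((a / (m * r)) ^ 2 * (1 / 16)) := by
        refine mul_le_mul_of_nonneg_right (by linarith) (by positivity)
    _ = ∑ b ∈ B, (a / (m * r)) ^ 2 * (1 / 16) := by simp
    _ ≤ ∑ b ∈ B, ∑ i, gradient (avg (blockChain e r a)) x (e (b, i)) ^ 2 :=
        Finset.sum_le_sum hblock
    _ ≤ ∑ b, ∑ i, gradient (avg (blockChain e r a)) x (e (b, i)) ^ 2 :=
        Finset.sum_le_sum_of_subset_of_nonneg (Finset.subset_univ _) fun _ _ _ =>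
          Finset.sum_nonneg fun _ _ => sq_nonneg _
    _ = _ := (norm_sq_eq_sum_blocks e _).symm

end BlockChain

/-! ### From incomplete blocks to lower bounds on the gradient. -/

lemma le_infGradSq {n m d T : ℕ} {A : ZeroRespectingAlgorithm n d} {τ : Fin n → ℝ}
    {f : Fin m → Vec d → ℝ} {ξ : ℕ → Fin m} {e : Fin m × Fin T ≃ Fin d} (hf : ZeroChain e f)
    (hn : 0 < n) (hτ : ∀ w, 0 < τ w) (hmono : Monotone τ) {t E : ℝ} (l : Fin T)
    (hl : (l : ℕ) + 1 = T) (hT : 8 * ⌊t / (equilibriumTime τ m / 4)⌋₊ + 2 ≤ 3 * T)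
    (hE : ∀ x : Vec d, m ≤ 2 * (Finset.univ.filter fun b => x (e (b, l)) = 0).card →
      E ≤ ‖gradient (avg f) x‖ ^ 2) :
    ENNReal.ofReal E ≤ infGradSq A τ f ξ t := by
  refine le_iInf₂ fun k hk => ?_
  have h := hE _ (card_incomplete A τ f ξ hf hτ (div_pos (equilibriumTime_pos hn hτ m) four_pos)
    (three_mul_sum_floor_le hn hτ hmono m) l hl hT k hk)
  refine (ENNReal.ofReal_le_ofReal h).trans_eq ?_
  rw [ENNReal.ofReal_pow (norm_nonneg _), ofReal_norm]

lemma infGradSq_anti {n m d : ℕ} (A : ZeroRespectingAlgorithm n d) (τ : Fin n → ℝ)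
    (f : Fin m → Vec d → ℝ) (ξ : ℕ → Fin m) : Antitone (infGradSq A τ f ξ) :=
  fun _ _ h => biInf_mono fun _ hk => le_trans (show _ ≤ _ from hk) h

/-- Chain functions are hard for time proportional to the equilibrium time times the length of
the chain. -/
lemma exists_hard_chain {n m : ℕ} {τ : Fin n → ℝ} {L δ ε : ℝ} (hn : 0 < n) (hm : 0 < m)
    (hτ : ∀ i, 0 < τ i) (hmono : Monotone τ) (hL : 0 < L) (hε : 0 < ε)
    (hlong : 24576 * √(m : ℝ) < δ * L / ε) :
    ∃ d : ℕ, ∃ f : Fin m → Vec d → ℝ, FunctionClass δ L f ∧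
      ∀ (A : ZeroRespectingAlgorithm n d) (ξ : ℕ → Fin m), ENNReal.ofReal (2 * ε) ≤
        infGradSq A τ f ξ (1 / 196608 * (δ * L / (√(m : ℝ) * ε)) * equilibriumTime τ m) := by
  have hm' : (0 : ℝ) < m := by exact_mod_cast hm
  have hsm : 0 < √(m : ℝ) := Real.sqrt_pos.2 hm'
  have hsε : 0 < √ε := Real.sqrt_pos.2 hε
  have hsm2 : √(m : ℝ) ^ 2 = m := Real.sq_sqrt hm'.le
  have hsε2 : √ε ^ 2 = ε := Real.sq_sqrt hε.le
  have hte := equilibriumTime_pos hn hτ m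
  set X := δ * L / (√(m : ℝ) * ε) with hX
  have hX1 : 24576 < X := by
    rw [hX, lt_div_iff₀ (mul_pos hsm hε)]
    rw [lt_div_iff₀ hε] at hlong
    linarith
  -- Chains of length `N - 1` are used: a chain of length `T + 1` costs the gap `4 * a * (T + 2) = 4
  -- * a * N`, and `4 * a = 6144 * √m * ε / L`.
  set N := ⌊X / 6144⌋₊ with hN
  have hN1 : X / 6144 < N + 1 := Nat.lt_floor_add_one _
  have hN2 : (N : ℝ) ≤ X / 6144 := Nat.floor_le (by linarith)
  have hN4 : 4 ≤ N := Nat.le_floor (by push_cast; linarith)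
  obtain ⟨T, hNT⟩ : ∃ T, N = T + 2 := ⟨N - 2, by omega⟩
  let e : Fin m × Fin (T + 1) ≃ Fin (m * (T + 1)) := finProdFinEquiv
  -- `r` and `a` solve `24 * a / r ^ 2 = √m * L` (smoothness) and `a ^ 2 / (32 * m * r ^ 2) = 2 * ε`
  -- (gradient size).
  set r := 192 * √ε / L with hr
  set a := 1536 * √(m : ℝ) * ε / L with ha
  have hr0 : 0 < r := by positivity
  refine ⟨m * (T + 1), blockChain e r a, functionClass_blockChain e r hm (by positivity) ?_ ?_, ?_⟩
  · have hNT' : (N : ℝ) = T + 2 := by exact_mod_cast hNT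
    have : 6144 * ((T : ℝ) + 2) ≤ X := by linarith
    rw [hX, le_div_iff₀ (mul_pos hsm hε)] at this
    rw [ha, div_mul_eq_mul_div, div_le_iff₀ hL]
    push_cast
    linarith
  · have : 24 * a / r ^ 2 = √(m : ℝ) * L := by
      rw [ha, hr, div_pow, mul_pow, hsε2]
      field_simp
      norm_num
    rw [this, mul_pow, hsm2]
  · intro A ξ
    refine le_infGradSq (zeroChain_blockChain e r a) hn hτ hmono (Fin.last T) (by simp) ?_ ?_
    · have h1 : 1 / 196608 * X * equilibriumTime τ m / (equilibriumTime τ m / 4) = X / 49152 := by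
        field_simp
        norm_num
      have h2 := Nat.floor_le (show 0 ≤ X / 49152 by linarith)
      rw [h1]
      -- Since `49152 = 8 * 6144`, the left side is below `N + 6`, and `4 ≤ N` suffices. The `5` is
      -- `2` plus the `3` lost to chain length `N - 1`.
      have h3 : (8 : ℝ) * ⌊X / 49152⌋₊ + 5 ≤ 3 * N := by linarith
      have h4 : 8 * ⌊X / 49152⌋₊ + 5 ≤ 3 * N := by exact_mod_cast h3
      omega
    · intro x hx
      refine le_trans (le_of_eq ?_)
        (le_norm_gradient_avg_blockChain e r a x (Fin.last T) (by simp) hx)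
      rw [ha, hr, div_pow, div_pow, mul_pow, mul_pow, mul_pow, hsε2, hsm2]
      field_simp
      norm_num

/-! ### Quadratics with blocks of length one. -/

section Quadratic

variable {m d : ℕ} (e : Fin m × Fin 1 ≃ Fin d) (L β : ℝ)

/-- A quadratic with curvature `L` whose linear part reveals a single coordinate. -/
noncomputable def tiltedQuadratic (b : Fin m) (x : Vec d) : ℝ :=
  L / 2 * ‖x‖ ^ 2 - m * β * x (e (b, 0))

lemma hasFDerivAt_tiltedQuadratic (b : Fin m) (x : Vec d) :
    HasFDerivAt (tiltedQuadratic e L β b)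
      ((L / 2) • (2 • innerSL ℝ x) - (m * β) • EuclideanSpace.proj (e (b, 0))) x := by
  have h1 := (hasStrictFDerivAt_norm_sq (F := Vec d) x).hasFDerivAt
  have h2 := (EuclideanSpace.proj (𝕜 := ℝ) (e (b, 0)) : Vec d →L[ℝ] ℝ).hasFDerivAt (x := x)
  exact (h1.const_mul (L / 2)).sub (h2.const_mul (m * β))

lemma differentiable_tiltedQuadratic (b : Fin m) : Differentiable ℝ (tiltedQuadratic e L β b) :=
  fun x => (hasFDerivAt_tiltedQuadratic e L β b x).differentiableAt

lemma gradient_tiltedQuadratic (b b' : Fin m) (i : Fin 1) (x : Vec d) :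
    gradient (tiltedQuadratic e L β b) x (e (b', i)) =
      L * x (e (b', i)) - if b = b' then m * β else 0 := by
  rw [gradient_apply (hasFDerivAt_tiltedQuadratic e L β b x), Subsingleton.elim i 0]
  simp [EuclideanSpace.inner_single_right]
  ring

lemma zeroChain_tiltedQuadratic : ZeroChain e (tiltedQuadratic e L β) := by
  intro j x p hx b i hne
  rw [gradient_tiltedQuadratic] at hne
  split_ifs at hne ⊢ with hb
  · omega
  · refine hx b i fun h => hne ?_
    rw [h]
    simp

lemma gradient_tiltedQuadratic_sub (b : Fin m) (x y : Vec d) :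
    gradient (tiltedQuadratic e L β b) x - gradient (tiltedQuadratic e L β b) y = L • (x - y) := by
  ext j
  obtain ⟨⟨b', i⟩, rfl⟩ := e.surjective j
  simp only [PiLp.sub_apply, PiLp.smul_apply, gradient_tiltedQuadratic, smul_eq_mul]
  ring

lemma avg_tiltedQuadratic (hm : 0 < m) (x : Vec d) :
    avg (tiltedQuadratic e L β) x = ∑ b, (L / 2 * x (e (b, 0)) ^ 2 - β * x (e (b, 0))) := by
  have hm' : (m : ℝ) ≠ 0 := by exact_mod_cast hm.ne'
  simp only [avg, tiltedQuadratic, norm_sq_eq_sum_blocks e, Finset.sum_sub_distrib,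
    Finset.sum_const, Finset.card_univ, Fintype.card_fin, nsmul_eq_mul, ← Finset.mul_sum,
    Fin.sum_univ_one]
  field_simp

lemma functionClass_tiltedQuadratic {δ : ℝ} (hm : 0 < m) (hL : 0 < L)
    (hδ : m * β ^ 2 ≤ 2 * L * δ) : FunctionClass δ L (tiltedQuadratic e L β) := by
  have hm' : (m : ℝ) ≠ 0 := by exact_mod_cast hm.ne'
  have hlow : ∀ x, -δ ≤ avg (tiltedQuadratic e L β) x := fun x => by
    rw [avg_tiltedQuadratic e L β hm]
    calc -δ ≤ ∑ _b : Fin m, -(β ^ 2 / (2 * L)) := by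
          simp only [Finset.sum_const, Finset.card_univ, Fintype.card_fin, nsmul_eq_mul, mul_neg]
          rw [neg_le_neg_iff, ← mul_div_assoc, div_le_iff₀ (by positivity)]
          linarith
      _ ≤ _ := Finset.sum_le_sum fun b _ => by
          rw [neg_le_iff_add_nonneg]
          have : L / 2 * x (e (b, 0)) ^ 2 - β * x (e (b, 0)) + β ^ 2 / (2 * L) =
              (L * x (e (b, 0)) - β) ^ 2 / (2 * L) := by
            field_simp
            ring
          rw [this]
          positivity
  refine ⟨differentiable_tiltedQuadratic e L β, ⟨-δ, ?_⟩, ?_, fun x y => ?_⟩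
  · rintro _ ⟨x, rfl⟩
    exact hlow x
  · have h0 : avg (tiltedQuadratic e L β) 0 = 0 := by simp [avg_tiltedQuadratic e L β hm]
    have := le_ciInf hlow
    linarith
  · simp only [gradient_tiltedQuadratic_sub, norm_smul, mul_pow, Real.norm_eq_abs, sq_abs,
      Finset.sum_const, Finset.card_univ, Fintype.card_fin, nsmul_eq_mul]
    refine le_of_eq ?_
    field_simp

lemma le_norm_gradient_avg_tiltedQuadratic (x : Vec d)
    (hx : m ≤ 2 * (Finset.univ.filter fun b => x (e (b, 0)) = 0).card) :
    m / 2 * β ^ 2 ≤ ‖gradient (avg (tiltedQuadratic e L β)) x‖ ^ 2 := by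
  classical
  rcases Nat.eq_zero_or_pos m with rfl | hm
  · simp
  have hm' : (m : ℝ) ≠ 0 := by exact_mod_cast hm.ne'
  set B := Finset.univ.filter fun b => x (e (b, 0)) = 0 with hB
  have hcard : (m : ℝ) ≤ 2 * B.card := by exact_mod_cast hx
  rw [norm_sq_eq_sum_blocks e]
  calc m / 2 * β ^ 2 ≤ B.card * β ^ 2 :=
        mul_le_mul_of_nonneg_right (by linarith) (sq_nonneg _)
    _ = ∑ _b ∈ B, β ^ 2 := by simp
    _ ≤ ∑ b ∈ B, ∑ i, gradient (avg (tiltedQuadratic e L β)) x (e (b, i)) ^ 2 := by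
        refine Finset.sum_le_sum fun b hb => le_of_eq ?_
        have hb : x (e (b, 0)) = 0 := (Finset.mem_filter.1 hb).2
        rw [Fin.sum_univ_one, gradient_avg_apply (differentiable_tiltedQuadratic e L β)]
        simp only [gradient_tiltedQuadratic, hb, Finset.sum_sub_distrib, Finset.sum_ite_eq',
          Finset.mem_univ, if_true]
        simp only [mul_zero, Finset.sum_const_zero, zero_sub]
        field_simp
    _ ≤ _ := Finset.sum_le_sum_of_subset_of_nonneg (Finset.subset_univ _) fun _ _ _ =>
          Finset.sum_nonneg fun _ _ => sq_nonneg _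

end Quadratic

/-- Quadratics are hard for a fraction of the equilibrium time. -/
lemma exists_hard_quadratic {n m : ℕ} {τ : Fin n → ℝ} {L δ t : ℝ} (hn : 0 < n) (hm : 0 < m)
    (hτ : ∀ i, 0 < τ i) (hmono : Monotone τ) (hL : 0 < L) (hδ : 0 < δ)
    (ht : t < equilibriumTime τ m / 4) :
    ∃ d : ℕ, ∃ f : Fin m → Vec d → ℝ, FunctionClass δ L f ∧
      ∀ (A : ZeroRespectingAlgorithm n d) (ξ : ℕ → Fin m),
        ENNReal.ofReal (L * δ) ≤ infGradSq A τ f ξ t := by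
  have hm' : (0 : ℝ) < m := by exact_mod_cast hm
  have hte := equilibriumTime_pos hn hτ m
  let e : Fin m × Fin 1 ≃ Fin (m * 1) := finProdFinEquiv
  -- This tilt uses up the gap exactly, `m * β ^ 2 / (2 * L) = δ`, and makes the gradient bound `m /
  -- 2 * β ^ 2` equal to `L * δ`.
  have hβ : √(2 * L * δ / m) ^ 2 = 2 * L * δ / m := Real.sq_sqrt (by positivity)
  refine ⟨m * 1, tiltedQuadratic e L √(2 * L * δ / m),
    functionClass_tiltedQuadratic e L _ hm hL ?_, fun A ξ => ?_⟩
  · rw [hβ]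
    exact le_of_eq (by field_simp)
  · refine le_infGradSq (zeroChain_tiltedQuadratic e L _) hn hτ hmono 0 rfl ?_ fun x hx => ?_
    · have : ⌊t / (equilibriumTime τ m / 4)⌋₊ = 0 :=
        Nat.floor_eq_zero.2 ((div_lt_one (by positivity)).2 ht)
      omega
    · refine le_trans (le_of_eq ?_) (le_norm_gradient_avg_tiltedQuadratic e L _ x hx)
      rw [hβ]
      field_simp

lemma ofReal_lt_lintegral {Ω : Type*} [MeasurableSpace Ω] (μ : Measure Ω) [IsProbabilityMeasure μ]
    {ε E : ℝ} (hE : 0 < E) (h : ε < E) {g : Ω → ℝ≥0∞} (hg : ∀ ω, ENNReal.ofReal E ≤ g ω) :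
    ENNReal.ofReal ε < ∫⁻ ω, g ω ∂μ := by
  refine ((ENNReal.ofReal_lt_ofReal_iff hE).2 h).trans_le ?_
  calc ENNReal.ofReal E = ∫⁻ _, ENNReal.ofReal E ∂μ := by simp
    _ ≤ _ := lintegral_mono hg

end TimeOracle

theorem mainTheorem2 :
    (∃ c₁ c₂ c₃ : ℝ, 0 < c₁ ∧ 0 < c₂ ∧ 0 < c₃ ∧
      ∀ (n m : ℕ) (τ : Fin n → ℝ) (L δ ε : ℝ), 0 < n → 0 < m → (∀ i, 0 < τ i) → Monotone τ →
        0 < L → 0 < δ → 0 < ε → ε < c₁ * (L * δ) → c₂ * √(m : ℝ) < δ * L / ε →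
        ∃ d : ℕ, ∀ A : TimeOracle.ZeroRespectingAlgorithm n d,
          ∃ f : Fin m → TimeOracle.Vec d → ℝ, TimeOracle.FunctionClass δ L f ∧
            ∀ (Ω : Type u) [MeasurableSpace Ω] (μ : MeasureTheory.Measure Ω)
              [MeasureTheory.IsProbabilityMeasure μ] (ξ : ℕ → Ω → Fin m),
              TimeOracle.IsUniformDraws μ ξ →
              ENNReal.ofReal ε < ∫⁻ ω, TimeOracle.infGradSq A τ f (fun k => ξ k ω)
                (c₃ * (δ * L / (√(m : ℝ) * ε)) * TimeOracle.equilibriumTime τ m) ∂μ) ∧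
    (∃ c₁ c : ℝ, 0 < c₁ ∧ 0 < c ∧
      ∀ (n m : ℕ) (τ : Fin n → ℝ) (L δ ε : ℝ), 0 < n → 0 < m → (∀ i, 0 < τ i) → Monotone τ →
        0 < L → 0 < δ → 0 < ε → ε < c₁ * (L * δ) →
        ∃ d : ℕ, ∀ A : TimeOracle.ZeroRespectingAlgorithm n d,
          ∃ f : Fin m → TimeOracle.Vec d → ℝ, TimeOracle.FunctionClass δ L f ∧
            ∀ (Ω : Type u) [MeasurableSpace Ω] (μ : MeasureTheory.Measure Ω)
              [MeasureTheory.IsProbabilityMeasure μ] (ξ : ℕ → Ω → Fin m),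
              TimeOracle.IsUniformDraws μ ξ →
              ENNReal.ofReal ε < ∫⁻ ω, TimeOracle.infGradSq A τ f (fun k => ξ k ω)
                (c * (TimeOracle.equilibriumTime τ m +
                  δ * L / (√(m : ℝ) * ε) * TimeOracle.equilibriumTime τ m)) ∂μ) := by
  constructor
  · refine ⟨1, 24576, 1 / 196608, by norm_num, by norm_num, by norm_num, ?_⟩
    intro n m τ L δ ε hn hm hτ hmono hL hδ hε _ hlong
    obtain ⟨d, f, hf, h⟩ := TimeOracle.exists_hard_chain hn hm hτ hmono hL hε hlong
    exact ⟨d, fun A => ⟨f, hf, fun Ω _ μ _ ξ _ =>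
      TimeOracle.ofReal_lt_lintegral μ (by linarith) (by linarith) fun ω => h A _⟩⟩
  -- Half of `1 / 196608`: for long chains the ratio is at least `1`, so the extra equilibrium time
  -- at most doubles the time. Otherwise the ratio is at most `24576`, and `24577 / 393216 < 1 / 4`
  -- is within reach of the quadratics.
  · refine ⟨1, 1 / 393216, by norm_num, by norm_num, ?_⟩
    intro n m τ L δ ε hn hm hτ hmono hL hδ hε hεδ
    have hm' : (0 : ℝ) < m := by exact_mod_cast hm
    have hsm : 0 < √(m : ℝ) := Real.sqrt_pos.2 hm'
    have hte := TimeOracle.equilibriumTime_pos hn hτ m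
    by_cases hlong : 24576 * √(m : ℝ) < δ * L / ε
    · obtain ⟨d, f, hf, h⟩ := TimeOracle.exists_hard_chain hn hm hτ hmono hL hε hlong
      refine ⟨d, fun A => ⟨f, hf, fun Ω _ μ _ ξ _ =>
        TimeOracle.ofReal_lt_lintegral μ (E := 2 * ε) (by linarith) (by linarith) fun ω =>
          (h A _).trans (TimeOracle.infGradSq_anti A τ f _ ?_)⟩⟩
      have hX : 1 ≤ δ * L / (√(m : ℝ) * ε) := by
        rw [le_div_iff₀ (mul_pos hsm hε)]
        rw [lt_div_iff₀ hε] at hlong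
        nlinarith [mul_pos hsm hε]
      nlinarith
    · have hX : δ * L / (√(m : ℝ) * ε) ≤ 24576 := by
        rw [div_le_iff₀ (mul_pos hsm hε)]
        rw [not_lt, div_le_iff₀ hε] at hlong
        linarith
      obtain ⟨d, f, hf, h⟩ := TimeOracle.exists_hard_quadratic hn hm hτ hmono hL hδ
        (t := 1 / 393216 * (TimeOracle.equilibriumTime τ m +
          δ * L / (√(m : ℝ) * ε) * TimeOracle.equilibriumTime τ m)) (by nlinarith)
      exact ⟨d, fun A => ⟨f, hf, fun Ω _ μ _ ξ _ =>
        TimeOracle.ofReal_lt_lintegral μ (by positivity) (by linarith) fun ω => h A _⟩⟩
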